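/- Conventions. A cone is a commutative monoid $(C,+,0)$ with a scalar multiplication by $\mathbb R_+=[0,\infty)$ satisfying $r(x+y)=rx+ry$, $(r+s)x=rx+sx$, $(rs)x=r(sx)$, $1x=x$, $0x=0$, $r0=0$. A topological cone is a cone with a $T_0$ topology such that $C\times C\to C$, $(x,y)\mapsto x+y$, and $\mathbb R_+\times C\to C$, $(r,x)\mapsto rx$, are jointly continuous, where $\mathbb R_+$ carries the Scott topology (open sets $\emptyset$, $\mathbb R_+$ and $(a,\infty)$ for $a\in\mathbb R_+$). A subset $A$ of a cone is convex if $ra+(1-r)b\in A$ for $a,b\in A$, $r\in[0,1]$, and a half-space if $A$ and its complement are convex. A topological cone is weakly locally convex if every open neighbourhood of a point contains a convex (not necessarily open) neighbourhood of that point, locally convex if every point has a neighbourhood basis of open convex sets, and locally linear if its topology has a subbase of open half-spaces. A $\mathsf K$-category $\mathcal K$ is a full subcategory of the category of $T_0$ spaces, whose objects are called $\mathcal K$-spaces, such that: (1) homeomorphic copies of $\mathcal K$-spaces are $\mathcal K$-spaces; (2) all sober spaces are $\mathcal K$-spaces; (3) in a sober space the intersection of any family of $\mathcal K$-subspaces is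 a $\mathcal K$-space; (4) if $f:S\to T$ is a continuous map between sober spaces and $A\subseteq T$ is a $\mathcal K$-subspace, then $f^{-1}(A)$ is a $\mathcal K$-subspace of $S$. For a $T_0$ space $X$, let $X^{\mathrm s}$ be the set of irreducible closed subsets of $X$ with the lower Vietoris topology. The $\mathcal K$-completion $\mathcal K_{\mathrm c}(X)$ is the smallest $\mathcal K$-subspace of $X^{\mathrm s}$ that contains all closures $\overline{\{x\}}$, $x\in X$, and $\eta_X:X\to\mathcal K_{\mathrm c}(X)$ is $x\mapsto\overline{\{x\}}$. A $\mathcal K$-cone is a topological cone that is a $\mathcal K$-space. Theorem. Let $\mathcal K$ be a $\mathsf K$-category and let $C$ be a topological cone. There is at most one cone structure on $\mathcal K_{\mathrm c}(C)$ that makes it a $\mathcal K$-cone for which $\eta_C$ is linear. Moreover, $C$ is locally convex (resp. locally linear, weakly locally convex) if and only if $\mathcal K_{\mathrm c}(C)$, with this cone structure, is a locally convex (resp. locally linear, weakly locally convex) $\mathcal K$-cone; that is, if and only if there is a cone structure on $\mathcal K_{\mathrm c}(C)$ that makes it a locally convex (resp. locally linear, weakly locally convex) $\mathcal K$-cone and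 for which $\eta_C$ is linear. -/

import Mathlib

open Topology Set
open scoped NNReal

universe u

/-! ### Topological cones

A cone is an `AddCommMonoid C` with a `Module ℝ≥0 C` structure. -/

/-- A topological cone: a cone with a `T₀` topology for which addition `C × C → C` and scalar
multiplication `ℝ₊ × C → C` are jointly continuous. Here `ℝ₊` carries its upper topology (the same
as its Scott topology), whose open sets are `∅`, the rays `(a, ∞)`, and `ℝ₊`. -/
structure IsTopologicalCone (C : Type u) [TopologicalSpace C] [AddCommMonoid C]
    [Module ℝ≥0 C] : Prop where
  t0 : T0Space C
  continuous_add : Continuous fun p : C × C => p.1 + p.2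
  continuous_smul : Continuous fun p : WithUpper ℝ≥0 × C => WithUpper.ofUpper p.1 • p.2

/-- A half-space is a convex set with convex complement. -/
def IsHalfSpace {C : Type u} [AddCommMonoid C] [Module ℝ≥0 C] (A : Set C) : Prop :=
  Convex ℝ≥0 A ∧ Convex ℝ≥0 Aᶜ

/-- Every open neighbourhood of a point contains a convex, not necessarily open, neighbourhood
of that point. -/
def IsWeaklyLocallyConvexCone (C : Type u) [TopologicalSpace C] [AddCommMonoid C]
    [Module ℝ≥0 C] : Prop :=
  ∀ (x : C) (U : Set C), IsOpen U → x ∈ U → ∃ N ⊆ U, N ∈ 𝓝 x ∧ Convex ℝ≥0 N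

/-- Each point has a neighbourhood basis of open convex sets. -/
def IsLocallyConvexCone (C : Type u) [TopologicalSpace C] [AddCommMonoid C]
    [Module ℝ≥0 C] : Prop :=
  ∀ (x : C) (U : Set C), IsOpen U → x ∈ U → ∃ W ⊆ U, x ∈ W ∧ IsOpen W ∧ Convex ℝ≥0 W

/-- The topology has a subbase of open half-spaces. -/
def IsLocallyLinearCone (C : Type u) [t : TopologicalSpace C] [AddCommMonoid C]
    [Module ℝ≥0 C] : Prop :=
  ∃ S : Set (Set C), (∀ A ∈ S, IsOpen A ∧ IsHalfSpace A) ∧ t = TopologicalSpace.generateFrom S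

/-! ### Sobrification, K-categories and K-completion -/

/-- A sober space: `T₀`, and every irreducible closed set is the closure of a point. -/
def IsSober (X : Type u) [TopologicalSpace X] : Prop := T0Space X ∧ QuasiSober X

/-- A class `K` of spaces whose full subcategory of the category of `T₀` spaces is a K-category.
A K-subspace of `S` is a subset `A` such that the subspace `A` belongs to `K`. -/
structure IsKCategory (K : ∀ (X : Type u) [TopologicalSpace X], Prop) : Prop where
  t0 : ∀ (X : Type u) [TopologicalSpace X], K X → T0Space X
  replete : ∀ (X Y : Type u) [TopologicalSpace X] [TopologicalSpace Y], (X ≃ₜ Y) → K X → K Y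
  of_sober : ∀ (X : Type u) [TopologicalSpace X], IsSober X → K X
  sInter : ∀ (S : Type u) [TopologicalSpace S], IsSober S → ∀ F : Set (Set S),
    (∀ A ∈ F, K A) → K (⋂₀ F)
  preimage : ∀ (S T : Type u) [TopologicalSpace S] [TopologicalSpace T], IsSober S → IsSober T →
    ∀ f : S → T, Continuous f → ∀ A : Set T, K A → K (f ⁻¹' A)

/-- The canonical sobrification: the set of irreducible closed subsets. -/
def Sobrification (X : Type u) [TopologicalSpace X] : Type u := TopologicalSpace.IrreducibleCloseds X

/-- The lower Vietoris topology. -/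
instance (X : Type u) [TopologicalSpace X] : TopologicalSpace (Sobrification X) :=
  TopologicalSpace.generateFrom
    {V | ∃ U : Set X, IsOpen U ∧ V = {A : Sobrification X | (A.carrier ∩ U).Nonempty}}

/-- The map `x ↦ closure {x}` from a space to its sobrification. -/
def Sobrification.unit (X : Type u) [TopologicalSpace X] (x : X) : Sobrification X :=
  ⟨closure {x}, isIrreducible_singleton.closure, isClosed_closure⟩

/-- The smallest K-subspace of the sobrification of `X` that contains the image of `X`. -/
def kCompletionSet (K : ∀ (X : Type u) [TopologicalSpace X], Prop) (X : Type u)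
    [TopologicalSpace X] : Set (Sobrification X) :=
  ⋂₀ {A | range (Sobrification.unit X) ⊆ A ∧ K A}

/-- The canonical K-completion of `X`, with the subspace topology. -/
abbrev KCompletion (K : ∀ (X : Type u) [TopologicalSpace X], Prop) (X : Type u)
    [TopologicalSpace X] : Type u := kCompletionSet K X

/-- The canonical embedding of `X` into its K-completion. -/
def KCompletion.unit (K : ∀ (X : Type u) [TopologicalSpace X], Prop) (X : Type u)
    [TopologicalSpace X] (x : X) : KCompletion K X :=
  ⟨Sobrification.unit X x, fun _ hA => hA.1 (mem_range_self x)⟩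

/-! ### Cone structures on the K-completion -/

/-- A cone structure on a type. -/
@[ext] structure ConeStructure (X : Type u) where
  addCommMonoid : AddCommMonoid X
  module : Module ℝ≥0 X

/-- The cone structure `s` makes the K-completion of `C` a K-cone (a topological cone that is also
a K-space), and it extends the cone structure of `C`: the canonical embedding is linear. -/
def IsKConeExtension (K : ∀ (X : Type u) [TopologicalSpace X], Prop) (C : Type u)
    [TopologicalSpace C] [AddCommMonoid C] [Module ℝ≥0 C]
    (s : ConeStructure (KCompletion K C)) : Prop :=
  letI := s.addCommMonoid
  letI := s.module
  K (KCompletion K C) ∧ IsTopologicalCone (KCompletion K C) ∧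
    IsLinearMap ℝ≥0 (KCompletion.unit K C)

/-! The open sets of the completion are exactly the traces of the sets `hit U` with `U` open in `C`,
and `U` is recovered as the preimage under the unit. Hence continuous maps into a `T₀` space that
agree on `C` are equal (`funext_of_unit`), which yields both uniqueness and the transfer of the cone
axioms.

The operations come from the sobrification, where a sum is the closure of the image of a product of
irreducible closed sets. Minimality of the completion and stability of K-subspaces under continuous
preimages show that they restrict (`mapsTo`).

Convexity transfers because `hit N` is convex for convex `N`, and the complement of `hit U` is
convex for open `U` with convex complement. Conversely, the unit is linear and inducing, so each
property pulls back to `C`. -/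

theorem IsIrreducible.prod {X Y : Type*} [TopologicalSpace X] [TopologicalSpace Y] {s : Set X}
    {t : Set Y} (hs : IsIrreducible s) (ht : IsIrreducible t) : IsIrreducible (s ×ˢ t) := by
  refine ⟨hs.nonempty.prod ht.nonempty, ?_⟩
  rintro U U' hU hU' ⟨⟨a, b⟩, ⟨ha, hb⟩, hab⟩ ⟨⟨a', b'⟩, ⟨ha', hb'⟩, hab'⟩
  obtain ⟨V, W, hV, hW, haV, hbW, hVW⟩ := isOpen_prod_iff.1 hU a b hab
  obtain ⟨V', W', hV', hW', haV', hbW', hVW'⟩ := isOpen_prod_iff.1 hU' a' b' hab'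
  obtain ⟨x, hx, hxV, hxV'⟩ := hs.isPreirreducible V V' hV hV' ⟨a, ha, haV⟩ ⟨a', ha', haV'⟩
  obtain ⟨y, hy, hyW, hyW'⟩ := ht.isPreirreducible W W' hW hW' ⟨b, hb, hbW⟩ ⟨b', hb', hbW'⟩
  exact ⟨(x, y), ⟨hx, hy⟩, hVW ⟨hxV, hyW⟩, hVW' ⟨hxV', hyW'⟩⟩

/-! ### Sobrification: open sets, soberness, functoriality, products. -/

namespace Sobrification

variable {X Y Z : Type u} [TopologicalSpace X] [TopologicalSpace Y] [TopologicalSpace Z]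

/-- The set of points of the sobrification that meet a given set. -/
def hit (U : Set X) : Set (Sobrification X) := {A | (A.carrier ∩ U).Nonempty}

theorem hit_mono {U V : Set X} (h : U ⊆ V) : hit U ⊆ hit V :=
  fun _ hA => hA.mono (inter_subset_inter_right _ h)

theorem isOpen_hit {U : Set X} (hU : IsOpen U) : IsOpen (hit U) :=
  TopologicalSpace.isOpen_generateFrom_of_mem ⟨U, hU, rfl⟩

/-- Irreducibility of the points is exactly what gives the nontrivial inclusion. -/
theorem hit_inter {U V : Set X} (hU : IsOpen U) (hV : IsOpen V) :
    hit (U ∩ V) = hit U ∩ hit V := by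
  ext A
  constructor
  · exact fun h => ⟨hit_mono inter_subset_left h, hit_mono inter_subset_right h⟩
  · rintro ⟨h₁, h₂⟩
    exact A.isIrreducible'.isPreirreducible U V hU hV h₁ h₂

theorem hit_univ : hit (univ : Set X) = univ :=
  eq_univ_of_forall fun A => by simpa [hit] using A.isIrreducible'.nonempty

theorem hit_sUnion (S : Set (Set X)) : hit (⋃₀ S) = ⋃₀ (hit '' S) := by
  ext A
  constructor
  · rintro ⟨x, hx, U, hU, hxU⟩
    exact ⟨hit U, mem_image_of_mem _ hU, x, hx, hxU⟩
  · rintro ⟨_, ⟨U, hU, rfl⟩, x, hx, hxU⟩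
    exact ⟨x, hx, U, hU, hxU⟩

theorem exists_eq_hit_of_isOpen {V : Set (Sobrification X)} (hV : IsOpen V) :
    ∃ U : Set X, IsOpen U ∧ V = hit U := by
  induction hV with
  | basic V h => exact h
  | univ => exact ⟨univ, isOpen_univ, hit_univ.symm⟩
  | inter V W _ _ hV hW =>
    obtain ⟨U, hU, rfl⟩ := hV
    obtain ⟨U', hU', rfl⟩ := hW
    exact ⟨U ∩ U', hU.inter hU', (hit_inter hU hU').symm⟩
  | sUnion S _ hS =>
    -- Taking all admissible `U` avoids choosing one for each member of `S`.
    refine ⟨⋃₀ {U | IsOpen U ∧ hit U ∈ S}, isOpen_sUnion fun U hU => hU.1, ?_⟩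
    rw [hit_sUnion]
    congr 1
    ext V
    constructor
    · intro hV
      obtain ⟨U, hU, rfl⟩ := hS V hV
      exact ⟨U, ⟨hU, hV⟩, rfl⟩
    · rintro ⟨U, hU, rfl⟩
      exact hU.2

theorem unit_mem_hit {U : Set X} (hU : IsOpen U) {x : X} : unit X x ∈ hit U ↔ x ∈ U := by
  constructor
  · rintro ⟨y, hy, hyU⟩
    exact (specializes_iff_mem_closure.2 hy).mem_open hU hyU
  · exact fun h => ⟨x, subset_closure rfl, h⟩

theorem continuous_of_isOpen_preimage_hit {f : Y → Sobrification X}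
    (h : ∀ U : Set X, IsOpen U → IsOpen (f ⁻¹' hit U)) : Continuous f :=
  continuous_generateFrom_iff.2 <| by
    rintro _ ⟨U, hU, rfl⟩
    exact h U hU

theorem continuous_unit : Continuous (unit X) :=
  continuous_of_isOpen_preimage_hit fun U hU => by
    convert hU using 1
    ext x
    exact unit_mem_hit hU

instance : T0Space (Sobrification X) where
  t0 := by
    have key : ∀ A B : Sobrification X, Inseparable A B → A.carrier ⊆ B.carrier := by
      intro A B h x hx
      by_contra hxB
      have hA : A ∈ hit B.carrierᶜ := ⟨x, hx, hxB⟩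
      obtain ⟨y, hy, hyB⟩ := (h.mem_open_iff (isOpen_hit B.isClosed'.isOpen_compl)).1 hA
      exact hyB hy
    intro A B h
    exact TopologicalSpace.IrreducibleCloseds.ext
      (Subset.antisymm (key A B h) (key B A h.symm))

instance : QuasiSober (Sobrification X) where
  sober := by
    intro S hS hSc
    obtain ⟨U, hU, hSU⟩ := exists_eq_hit_of_isOpen hSc.isOpen_compl
    -- A closed set consists of the points contained in one closed set `Uᶜ`, so `Uᶜ` is its generic
    -- point once it is known to be irreducible.
    have mem_S : ∀ B : Sobrification X, B ∈ S ↔ B.carrier ⊆ Uᶜ := by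
      intro B
      rw [← not_iff_not, ← mem_compl_iff, hSU, not_subset]
      simp [hit, Set.Nonempty]
    have unit_mem : ∀ x ∈ Uᶜ, unit X x ∈ S := fun x hx =>
      (mem_S _).2 (closure_minimal (singleton_subset_iff.2 hx) hU.isClosed_compl)
    have hirr : IsIrreducible Uᶜ := by
      constructor
      · obtain ⟨B, hB⟩ := hS.nonempty
        exact B.isIrreducible'.nonempty.mono ((mem_S B).1 hB)
      · rintro V W hV hW ⟨x, hx, hxV⟩ ⟨y, hy, hyW⟩
        obtain ⟨B, hB, hBVW⟩ := hS.isPreirreducible (hit V) (hit W) (isOpen_hit hV)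
          (isOpen_hit hW) ⟨_, unit_mem x hx, (unit_mem_hit hV).2 hxV⟩
          ⟨_, unit_mem y hy, (unit_mem_hit hW).2 hyW⟩
        rw [← hit_inter hV hW] at hBVW
        exact hBVW.mono (inter_subset_inter_left _ ((mem_S B).1 hB))
    refine ⟨⟨Uᶜ, hirr, hU.isClosed_compl⟩, Subset.antisymm ?_ ?_⟩
    · exact closure_minimal (singleton_subset_iff.2 ((mem_S _).2 Subset.rfl)) hSc
    · intro B hB
      refine mem_closure_iff.2 fun V hV hBV => ?_
      obtain ⟨W, hW, rfl⟩ := exists_eq_hit_of_isOpen hV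
      exact ⟨_, hBV.mono (inter_subset_inter_left _ ((mem_S B).1 hB)), rfl⟩

theorem isSober : IsSober (Sobrification X) := ⟨inferInstance, inferInstance⟩

/-- The functorial action of sobrification on a continuous map. -/
def map (f : X → Y) (hf : Continuous f) (A : Sobrification X) : Sobrification Y :=
  ⟨closure (f '' A.carrier), (A.isIrreducible'.image f hf.continuousOn).closure,
    isClosed_closure⟩

theorem map_mem_hit {f : X → Y} (hf : Continuous f) {A : Sobrification X} {U : Set Y}
    (hU : IsOpen U) : map f hf A ∈ hit U ↔ ∃ a ∈ A.carrier, f a ∈ U := by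
  change (closure (f '' A.carrier) ∩ U).Nonempty ↔ _
  rw [closure_inter_open_nonempty_iff hU]
  constructor
  · rintro ⟨_, ⟨a, ha, rfl⟩, h⟩
    exact ⟨a, ha, h⟩
  · rintro ⟨a, ha, h⟩
    exact ⟨_, mem_image_of_mem f ha, h⟩

theorem map_unit {f : X → Y} (hf : Continuous f) (x : X) :
    map f hf (unit X x) = unit Y (f x) := by
  refine TopologicalSpace.IrreducibleCloseds.ext ?_
  change closure (f '' closure {x}) = closure {f x}
  rw [closure_image_closure hf, image_singleton]

/-- The product of two points of the sobrifications, as a point of the sobrification of the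
product. -/
def prod (A : Sobrification X) (B : Sobrification Y) : Sobrification (X × Y) :=
  ⟨A.carrier ×ˢ B.carrier, A.isIrreducible'.prod B.isIrreducible',
    A.isClosed'.prod B.isClosed'⟩

theorem prod_unit (x : X) (y : Y) : prod (unit X x) (unit Y y) = unit (X × Y) (x, y) := by
  refine TopologicalSpace.IrreducibleCloseds.ext ?_
  change closure {x} ×ˢ closure {y} = closure {(x, y)}
  rw [← closure_prod_eq, singleton_prod_singleton]

/-- A jointly continuous family of maps induces a jointly continuous family of maps of
sobrifications. -/
theorem continuous_map_uncurry {P : Type*} [TopologicalSpace P] {f : P → X → Y}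
    (hf : Continuous fun p : P × X => f p.1 p.2) (hf' : ∀ p, Continuous (f p)) :
    Continuous fun p : P × Sobrification X => map (f p.1) (hf' p.1) p.2 := by
  refine continuous_generateFrom_iff.2 ?_
  rintro _ ⟨U, hU, rfl⟩
  rw [isOpen_iff_mem_nhds]
  rintro ⟨p, A⟩ h
  obtain ⟨a, ha, hpa⟩ := (map_mem_hit (hf' p) hU).1 h
  obtain ⟨V, W, hV, hW, hpV, haW, hVW⟩ :=
    isOpen_prod_iff.1 (hU.preimage hf) p a hpa
  filter_upwards [(hV.prod (isOpen_hit hW)).mem_nhds ⟨hpV, a, ha, haW⟩]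
  rintro ⟨q, B⟩ ⟨hq, b, hb, hbW⟩
  exact (map_mem_hit (hf' q) hU).2 ⟨b, hb, hVW (mk_mem_prod hq hbW)⟩

theorem continuous_prod :
    Continuous fun p : Sobrification X × Sobrification Y => prod p.1 p.2 := by
  refine continuous_of_isOpen_preimage_hit fun U hU => ?_
  rw [isOpen_iff_mem_nhds]
  rintro ⟨A, B⟩ ⟨⟨a, b⟩, ⟨ha, hb⟩, hab⟩
  obtain ⟨V, W, hV, hW, haV, hbW, hVW⟩ := isOpen_prod_iff.1 hU a b hab
  filter_upwards [((isOpen_hit hV).prod (isOpen_hit hW)).mem_nhds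
    ⟨⟨a, ha, haV⟩, ⟨b, hb, hbW⟩⟩]
  rintro ⟨A', B'⟩ ⟨⟨a', ha', haV'⟩, ⟨b', hb', hbW'⟩⟩
  exact ⟨(a', b'), ⟨ha', hb'⟩, hVW ⟨haV', hbW'⟩⟩

theorem continuous_map {f : X → Y} (hf : Continuous f) : Continuous (map f hf) :=
  (continuous_map_uncurry (P := Unit) (f := fun _ => f) (hf.comp continuous_snd)
    fun _ => hf).comp (continuous_const.prodMk continuous_id : Continuous fun A => ((), A))

end Sobrification

/-! ### The K-completion and its extension principle. -/

namespace KCompletion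

open Sobrification

variable {K : ∀ (X : Type u) [TopologicalSpace X], Prop} {X : Type u} [TopologicalSpace X]

theorem isK (hK : IsKCategory K) : K (KCompletion K X) :=
  hK.sInter _ Sobrification.isSober _ fun _ hA => hA.2

/-- A continuous self-map of the sobrification that sends the points of `X` into the
K-completion preserves the K-completion. -/
theorem mapsTo (hK : IsKCategory K) {f : Sobrification X → Sobrification X} (hf : Continuous f)
    (h : ∀ x, f (Sobrification.unit X x) ∈ kCompletionSet K X) {A : Sobrification X}
    (hA : A ∈ kCompletionSet K X) : f A ∈ kCompletionSet K X :=
  -- The preimage is a K-subspace containing the image of `X`, so minimality applies.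
  hA (f ⁻¹' kCompletionSet K X) ⟨range_subset_iff.2 h,
    hK.preimage _ _ Sobrification.isSober Sobrification.isSober f hf _ (isK hK)⟩

theorem exists_eq_hit_of_isOpen {V : Set (KCompletion K X)} (hV : IsOpen V) :
    ∃ U : Set X, IsOpen U ∧ V = Subtype.val ⁻¹' hit U := by
  obtain ⟨W, hW, rfl⟩ := isOpen_induced_iff.1 hV
  obtain ⟨U, hU, rfl⟩ := Sobrification.exists_eq_hit_of_isOpen hW
  exact ⟨U, hU, rfl⟩

theorem unit_preimage_hit {U : Set X} (hU : IsOpen U) :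
    unit K X ⁻¹' (Subtype.val ⁻¹' hit U) = U := by
  ext x
  exact unit_mem_hit hU

theorem isInducing_unit : IsInducing (unit K X) := by
  refine ⟨le_antisymm ?_ ?_⟩
  · exact continuous_iff_le_induced.1 (continuous_unit.subtype_mk _)
  · intro U hU
    exact ⟨_, (isOpen_hit hU).preimage continuous_subtype_val, unit_preimage_hit hU⟩

/-- Continuous maps into a `T₀` space that agree on `X` agree on the K-completion. -/
theorem funext_of_unit {Z : Type*} [TopologicalSpace Z] [T0Space Z] {f g : KCompletion K X → Z}
    (hf : Continuous f) (hg : Continuous g) (h : ∀ x, f (unit K X x) = g (unit K X x)) :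
    ∀ A, f A = g A := by
  refine fun A => Inseparable.eq (inseparable_iff_forall_isOpen.2 fun W hW => ?_)
  obtain ⟨U, hU, hfU⟩ := exists_eq_hit_of_isOpen (hW.preimage hf)
  obtain ⟨V, hV, hgV⟩ := exists_eq_hit_of_isOpen (hW.preimage hg)
  have hUV : U = V := by
    rw [← unit_preimage_hit (K := K) hU, ← unit_preimage_hit (K := K) hV, ← hfU, ← hgV]
    ext x
    simp only [mem_preimage, h]
  change A ∈ f ⁻¹' W ↔ A ∈ g ⁻¹' W
  rw [hfU, hgV, hUV]

end KCompletion

namespace IsTopologicalCone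

variable {C : Type u} [TopologicalSpace C] [AddCommMonoid C] [Module ℝ≥0 C]

theorem continuous_const_smul (hC : IsTopologicalCone C) (r : ℝ≥0) :
    Continuous fun x : C => r • x :=
  hC.continuous_smul.comp
    (continuous_const.prodMk continuous_id : Continuous fun x : C => (WithUpper.toUpper r, x))

theorem continuous_const_add (hC : IsTopologicalCone C) (y : C) :
    Continuous fun x : C => y + x :=
  hC.continuous_add.comp (continuous_const.prodMk continuous_id)

theorem continuous_add_const (hC : IsTopologicalCone C) (y : C) :
    Continuous fun x : C => x + y :=
  hC.continuous_add.comp (continuous_id.prodMk continuous_const)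

end IsTopologicalCone

namespace KCompletion

open Sobrification

variable {K : ∀ (X : Type u) [TopologicalSpace X], Prop} {C : Type u} [TopologicalSpace C]
  [AddCommMonoid C] [Module ℝ≥0 C]

/-- Two structures agree on `C` by linearity. Separate continuity then extends the agreement, one
argument at a time. -/
theorem coneStructure_unique {s s' : ConeStructure (KCompletion K C)}
    (hs : IsKConeExtension K C s) (hs' : IsKConeExtension K C s') : s = s' := by
  obtain ⟨m, M⟩ := s
  obtain ⟨m', M'⟩ := s'
  obtain ⟨-, hT, hL⟩ := hs
  obtain ⟨-, hT', hL'⟩ := hs'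
  have := @IsTopologicalCone.t0 _ _ m M hT
  have hadd : ∀ A B : KCompletion K C, m.add A B = m'.add A B := by
    have h : ∀ (x : C) (B : KCompletion K C), m.add (unit K C x) B = m'.add (unit K C x) B :=
      fun x => funext_of_unit (@IsTopologicalCone.continuous_const_add _ _ m M hT _)
        (@IsTopologicalCone.continuous_const_add _ _ m' M' hT' _)
        fun y => (@IsLinearMap.map_add _ _ _ _ _ m _ M _ hL x y).symm.trans
          (@IsLinearMap.map_add _ _ _ _ _ m' _ M' _ hL' x y)
    exact fun A B => funext_of_unit (@IsTopologicalCone.continuous_add_const _ _ m M hT B)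
      (@IsTopologicalCone.continuous_add_const _ _ m' M' hT' B) (fun x => h x B) A
  obtain rfl : m = m' := AddCommMonoid.ext (funext fun A => funext fun B => hadd A B)
  obtain rfl : M = M' := by
    refine Module.ext' _ _ fun r => ?_
    exact funext_of_unit (@IsTopologicalCone.continuous_const_smul _ _ m M hT r)
      (@IsTopologicalCone.continuous_const_smul _ _ m M' hT' r)
      fun x => (@IsLinearMap.map_smul _ _ _ _ _ m _ M _ hL r x).symm.trans
        (@IsLinearMap.map_smul _ _ _ _ _ m _ M' _ hL' r x)
  rfl

/-! ### The cone structure on the K-completion. -/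

/-- Addition on the sobrification of a topological cone. -/
def sobAdd (hC : IsTopologicalCone C) (A B : Sobrification C) : Sobrification C :=
  map (fun p : C × C => p.1 + p.2) hC.continuous_add (A.prod B)

/-- Scalar multiplication on the sobrification of a topological cone. -/
def sobSMul (hC : IsTopologicalCone C) (r : ℝ≥0) (A : Sobrification C) : Sobrification C :=
  map (fun x : C => r • x) (hC.continuous_const_smul r) A

theorem continuous_sobAdd (hC : IsTopologicalCone C) :
    Continuous fun p : Sobrification C × Sobrification C => sobAdd hC p.1 p.2 :=
  (continuous_map hC.continuous_add).comp continuous_prod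

theorem continuous_sobSMul (hC : IsTopologicalCone C) :
    Continuous fun p : WithUpper ℝ≥0 × Sobrification C => sobSMul hC (WithUpper.ofUpper p.1) p.2 :=
  continuous_map_uncurry (f := fun (r : WithUpper ℝ≥0) (x : C) => WithUpper.ofUpper r • x)
    hC.continuous_smul fun r => hC.continuous_const_smul (WithUpper.ofUpper r)

theorem sobAdd_unit (hC : IsTopologicalCone C) (x y : C) :
    sobAdd hC (Sobrification.unit C x) (Sobrification.unit C y) =
      Sobrification.unit C (x + y) := by
  rw [sobAdd, prod_unit, map_unit]

theorem sobSMul_unit (hC : IsTopologicalCone C) (r : ℝ≥0) (x : C) :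
    sobSMul hC r (Sobrification.unit C x) = Sobrification.unit C (r • x) :=
  map_unit _ x

theorem sobAdd_mem (hK : IsKCategory K) (hC : IsTopologicalCone C) {A B : Sobrification C}
    (hA : A ∈ kCompletionSet K C) (hB : B ∈ kCompletionSet K C) :
    sobAdd hC A B ∈ kCompletionSet K C := by
  -- `mapsTo` concerns self-maps in one variable, so first `A` and then `B` is reduced to a point of
  -- `C`.
  refine mapsTo hK (f := fun A => sobAdd hC A B)
    ((continuous_sobAdd hC).comp (continuous_id.prodMk continuous_const)) (fun x => ?_) hA
  refine mapsTo hK (f := fun B => sobAdd hC (Sobrification.unit C x) B)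
    ((continuous_sobAdd hC).comp (continuous_const.prodMk continuous_id)) (fun y => ?_) hB
  simp only [sobAdd_unit]
  exact (unit K C (x + y)).2

theorem sobSMul_mem (hK : IsKCategory K) (hC : IsTopologicalCone C) (r : ℝ≥0)
    {A : Sobrification C} (hA : A ∈ kCompletionSet K C) :
    sobSMul hC r A ∈ kCompletionSet K C := by
  refine mapsTo hK (continuous_map (hC.continuous_const_smul r)) (fun x => ?_) hA
  rw [map_unit]
  exact (unit K C (r • x)).2

section Structure

variable (hK : IsKCategory K) (hC : IsTopologicalCone C)

/-- Addition on the K-completion of a topological cone. -/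
def add (A B : KCompletion K C) : KCompletion K C := ⟨sobAdd hC A B, sobAdd_mem hK hC A.2 B.2⟩

/-- Scalar multiplication on the K-completion of a topological cone. -/
def smul (r : ℝ≥0) (A : KCompletion K C) : KCompletion K C :=
  ⟨sobSMul hC r A, sobSMul_mem hK hC r A.2⟩

theorem continuous_add : Continuous fun p : KCompletion K C × KCompletion K C =>
    add hK hC p.1 p.2 :=
  ((continuous_sobAdd hC).comp (continuous_subtype_val.prodMap continuous_subtype_val)).subtype_mk
    _

theorem continuous_smul : Continuous fun p : WithUpper ℝ≥0 × KCompletion K C =>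
    smul hK hC (WithUpper.ofUpper p.1) p.2 :=
  ((continuous_sobSMul hC).comp (continuous_id.prodMap continuous_subtype_val)).subtype_mk _

theorem continuous_const_smul (r : ℝ≥0) : Continuous (smul (C := C) hK hC r) :=
  (continuous_smul hK hC).comp (continuous_const.prodMk continuous_id :
    Continuous fun A : KCompletion K C => (WithUpper.toUpper r, A))

theorem continuous_add₂ {Z : Type*} [TopologicalSpace Z] {f g : Z → KCompletion K C}
    (hf : Continuous f) (hg : Continuous g) : Continuous fun z => add hK hC (f z) (g z) :=
  (continuous_add hK hC).comp (hf.prodMk hg)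

theorem add_unit (x y : C) : add hK hC (unit K C x) (unit K C y) = unit K C (x + y) :=
  Subtype.ext (sobAdd_unit hC x y)

theorem smul_unit (r : ℝ≥0) (x : C) : smul hK hC r (unit K C x) = unit K C (r • x) :=
  Subtype.ext (sobSMul_unit hC r x)

/-- The additive monoid structure on the K-completion of a topological cone. -/
abbrev addCommMonoid : AddCommMonoid (KCompletion K C) :=
  letI : Add (KCompletion K C) := ⟨add hK hC⟩
  letI : Zero (KCompletion K C) := ⟨unit K C 0⟩
  -- Each axiom equates maps continuous in each variable; replacing the variables in turn by points
  -- of `C` reduces it to the axiom there.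
  have zero_add : ∀ A : KCompletion K C, add hK hC (unit K C 0) A = A :=
    funext_of_unit (continuous_add₂ hK hC continuous_const continuous_id) continuous_id
      fun x => by rw [add_unit, _root_.zero_add]
  have add_comm : ∀ A B : KCompletion K C, add hK hC A B = add hK hC B A := by
    intro A B
    refine funext_of_unit (continuous_add₂ hK hC continuous_id continuous_const)
      (continuous_add₂ hK hC continuous_const continuous_id) (fun x => ?_) A
    refine funext_of_unit (continuous_add₂ hK hC continuous_const continuous_id)
      (continuous_add₂ hK hC continuous_id continuous_const) (fun y => ?_) B
    simp only [id, add_unit, _root_.add_comm x]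
  have add_assoc : ∀ A B D : KCompletion K C,
      add hK hC (add hK hC A B) D = add hK hC A (add hK hC B D) := by
    intro A B D
    refine funext_of_unit
      (continuous_add₂ hK hC (continuous_add₂ hK hC continuous_id continuous_const)
        continuous_const)
      (continuous_add₂ hK hC continuous_id continuous_const) (fun x => ?_) A
    refine funext_of_unit
      (continuous_add₂ hK hC (continuous_add₂ hK hC continuous_const continuous_id)
        continuous_const)
      (continuous_add₂ hK hC continuous_const
        (continuous_add₂ hK hC continuous_id continuous_const)) (fun y => ?_) B
    refine funext_of_unit (continuous_add₂ hK hC continuous_const continuous_id)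
      (continuous_add₂ hK hC continuous_const
        (continuous_add₂ hK hC continuous_const continuous_id)) (fun z => ?_) D
    simp only [id, add_unit, _root_.add_assoc]
  { add := add hK hC
    zero := unit K C 0
    zero_add := zero_add
    add_zero := fun A => (add_comm A _).trans (zero_add A)
    add_comm := add_comm
    add_assoc := add_assoc
    nsmul := nsmulRec }

/-- The scalar multiplication on the K-completion of a topological cone. -/
abbrev module : @Module ℝ≥0 (KCompletion K C) _ (addCommMonoid hK hC) :=
  have one_smul : ∀ A : KCompletion K C, smul hK hC 1 A = A :=
    funext_of_unit (continuous_const_smul hK hC 1) continuous_id fun x => by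
      rw [smul_unit, _root_.one_smul]
  have mul_smul : ∀ (r s : ℝ≥0) (A : KCompletion K C),
      smul hK hC (r * s) A = smul hK hC r (smul hK hC s A) := fun r s =>
    funext_of_unit (continuous_const_smul hK hC (r * s))
      ((continuous_const_smul hK hC r).comp (continuous_const_smul hK hC s)) fun x => by
        simp only [smul_unit, SemigroupAction.mul_smul]
  have smul_zero : ∀ r : ℝ≥0, smul hK hC r (unit K C 0) = unit K C 0 := fun r => by
    rw [smul_unit, _root_.smul_zero]
  have zero_smul : ∀ A : KCompletion K C, smul hK hC 0 A = unit K C 0 :=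
    funext_of_unit (continuous_const_smul hK hC 0) continuous_const fun x => by
      rw [smul_unit, _root_.zero_smul]
  have smul_add : ∀ (r : ℝ≥0) (A B : KCompletion K C),
      smul hK hC r (add hK hC A B) = add hK hC (smul hK hC r A) (smul hK hC r B) := by
    intro r A B
    refine funext_of_unit
      ((continuous_const_smul hK hC r).comp
        (continuous_add₂ hK hC continuous_id continuous_const))
      (continuous_add₂ hK hC (continuous_const_smul hK hC r) continuous_const)
      (fun x => ?_) A
    refine funext_of_unit
      ((continuous_const_smul hK hC r).comp
        (continuous_add₂ hK hC continuous_const continuous_id))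
      (continuous_add₂ hK hC continuous_const (continuous_const_smul hK hC r))
      (fun y => ?_) B
    simp only [Function.comp, id, add_unit, smul_unit, _root_.smul_add]
  have add_smul : ∀ (r s : ℝ≥0) (A : KCompletion K C),
      smul hK hC (r + s) A = add hK hC (smul hK hC r A) (smul hK hC s A) := fun r s =>
    funext_of_unit (continuous_const_smul hK hC (r + s))
      (continuous_add₂ hK hC (continuous_const_smul hK hC r) (continuous_const_smul hK hC s))
      fun x => by simp only [add_unit, smul_unit, _root_.add_smul]
  letI := addCommMonoid (C := C) hK hC
  { smul := smul hK hC
    one_smul := one_smul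
    mul_smul := mul_smul
    smul_zero := smul_zero
    zero_smul := zero_smul
    smul_add := smul_add
    add_smul := add_smul }

/-- The cone structure on the K-completion of a topological cone. -/
abbrev coneStructure : ConeStructure (KCompletion K C) := ⟨addCommMonoid hK hC, module hK hC⟩

theorem isKConeExtension_coneStructure : IsKConeExtension K C (coneStructure hK hC) := by
  let _ := addCommMonoid (C := C) hK hC
  let _ := module (C := C) hK hC
  exact ⟨isK hK, ⟨hK.t0 _ (isK hK), continuous_add hK hC, continuous_smul hK hC⟩,
    ⟨fun x y => (add_unit hK hC x y).symm, fun r x => (smul_unit hK hC r x).symm⟩⟩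

/-! ### Transfer of convexity to the K-completion. -/

/-- The points of the K-completion that meet a convex set form a convex set. -/
theorem convex_preimage_hit {N : Set C} (hN : Convex ℝ≥0 N) :
    letI := addCommMonoid (C := C) hK hC
    letI := module (C := C) hK hC
    Convex ℝ≥0 (Subtype.val ⁻¹' hit N : Set (KCompletion K C)) := by
  let _ := addCommMonoid (C := C) hK hC
  let _ := module (C := C) hK hC
  rintro A ⟨a, ha, haN⟩ B ⟨b, hb, hbN⟩ r s hr hs hrs
  -- The witness already lies in the sum before closures are taken, so `N` need not be open; this
  -- covers weak local convexity.
  exact ⟨r • a + s • b, subset_closure ⟨(r • a, s • b),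
    ⟨subset_closure ⟨a, ha, rfl⟩, subset_closure ⟨b, hb, rfl⟩⟩, rfl⟩, hN haN hbN hr hs hrs⟩

/-- The points of the K-completion that avoid an open set with convex complement form a convex
set. -/
theorem convex_preimage_hit_compl {U : Set C} (hU : IsOpen U) (hUc : Convex ℝ≥0 Uᶜ) :
    letI := addCommMonoid (C := C) hK hC
    letI := module (C := C) hK hC
    Convex ℝ≥0 (Subtype.val ⁻¹' hit U : Set (KCompletion K C))ᶜ := by
  let _ := addCommMonoid (C := C) hK hC
  let _ := module (C := C) hK hC
  intro A hA B hB r s hr hs hrs hAB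
  -- Openness removes the closures: first that of the sum, then, through a box `V ×ˢ W`, those of
  -- the two scalar multiples. This leaves `a` and `b` outside `U` with their convex combination
  -- inside.
  obtain ⟨⟨x, y⟩, ⟨hx, hy⟩, hxy⟩ := (map_mem_hit hC.continuous_add hU).1 hAB
  obtain ⟨V, W, hV, hW, hxV, hyW, hVW⟩ :=
    isOpen_prod_iff.1 (hU.preimage hC.continuous_add) x y hxy
  obtain ⟨a, ha, haV⟩ := (map_mem_hit (hC.continuous_const_smul r) hV).1 ⟨x, hx, hxV⟩
  obtain ⟨b, hb, hbW⟩ := (map_mem_hit (hC.continuous_const_smul s) hW).1 ⟨y, hy, hyW⟩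
  exact hUc (fun h => hA ⟨a, ha, h⟩) (fun h => hB ⟨b, hb, h⟩) hr hs hrs
    (hVW (mk_mem_prod haV hbW))

theorem isLocallyConvexCone (h : IsLocallyConvexCone C) :
    @IsLocallyConvexCone (KCompletion K C) _ (addCommMonoid hK hC) (module hK hC) := by
  intro A V hV hA
  obtain ⟨U, hU, rfl⟩ := exists_eq_hit_of_isOpen hV
  obtain ⟨a, ha, haU⟩ := hA
  obtain ⟨W, hWU, haW, hW, hWc⟩ := h a U hU haU
  exact ⟨_, preimage_mono (hit_mono hWU), ⟨a, ha, haW⟩,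
    (isOpen_hit hW).preimage continuous_subtype_val, convex_preimage_hit hK hC hWc⟩

theorem isWeaklyLocallyConvexCone (h : IsWeaklyLocallyConvexCone C) :
    @IsWeaklyLocallyConvexCone (KCompletion K C) _ (addCommMonoid hK hC) (module hK hC) := by
  intro A V hV hA
  obtain ⟨U, hU, rfl⟩ := exists_eq_hit_of_isOpen hV
  obtain ⟨a, ha, haU⟩ := hA
  obtain ⟨N, hNU, hN, hNc⟩ := h a U hU haU
  refine ⟨_, preimage_mono (hit_mono hNU), ?_, convex_preimage_hit hK hC hNc⟩
  refine Filter.mem_of_superset (((isOpen_hit (isOpen_interior (s := N))).preimage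
    continuous_subtype_val).mem_nhds ?_) (preimage_mono (hit_mono interior_subset))
  exact ⟨a, ha, mem_interior_iff_mem_nhds.2 hN⟩

/-- On open sets `hit` commutes with finite intersections and arbitrary unions, so it carries a
subbase to a subbase. -/
theorem generateFrom_preimage_hit {X : Type u} [t : TopologicalSpace X] {S : Set (Set X)}
    (hS : t = TopologicalSpace.generateFrom S) :
    (inferInstance : TopologicalSpace (KCompletion K X)) =
      TopologicalSpace.generateFrom ((fun U => Subtype.val ⁻¹' hit U) '' S) := by
  have isOpen_of_mem : ∀ U ∈ S, IsOpen U := fun U hU => by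
    rw [hS]
    exact TopologicalSpace.isOpen_generateFrom_of_mem hU
  refine le_antisymm (le_generateFrom ?_) fun V hV => ?_
  · rintro _ ⟨U, hU, rfl⟩
    exact (isOpen_hit (isOpen_of_mem U hU)).preimage continuous_subtype_val
  · obtain ⟨U, hU, rfl⟩ := exists_eq_hit_of_isOpen hV
    have hU' : TopologicalSpace.GenerateOpen S U := by
      rw [hS] at hU
      exact hU
    have of_generateOpen : ∀ {U}, TopologicalSpace.GenerateOpen S U → IsOpen U := fun h => by
      rw [hS]
      exact h
    clear hU hV
    induction hU' with
    | basic U hU => exact TopologicalSpace.GenerateOpen.basic _ ⟨U, hU, rfl⟩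
    | univ =>
      rw [hit_univ]
      exact TopologicalSpace.GenerateOpen.univ
    | inter U W hU hW ihU ihW =>
      rw [hit_inter (of_generateOpen hU) (of_generateOpen hW)]
      exact TopologicalSpace.GenerateOpen.inter _ _ ihU ihW
    | sUnion T _ ih =>
      rw [hit_sUnion, preimage_sUnion, biUnion_image, ← sUnion_image]
      refine TopologicalSpace.GenerateOpen.sUnion _ ?_
      rintro _ ⟨U, hU, rfl⟩
      exact ih U hU

theorem isLocallyLinearCone (h : IsLocallyLinearCone C) :
    @IsLocallyLinearCone (KCompletion K C) _ (addCommMonoid hK hC) (module hK hC) := by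
  obtain ⟨S, hS, hgen⟩ := h
  refine ⟨_, ?_, generateFrom_preimage_hit hgen⟩
  rintro _ ⟨U, hU, rfl⟩
  obtain ⟨ho, hc, hc'⟩ := hS U hU
  exact ⟨(isOpen_hit ho).preimage continuous_subtype_val, convex_preimage_hit hK hC hc,
    convex_preimage_hit_compl hK hC ho hc'⟩

end Structure

end KCompletion

/-! ### Pulling back along linear inducing maps. -/

section Pullback

variable {C D : Type u} [TopologicalSpace C] [AddCommMonoid C] [Module ℝ≥0 C]
  [AddCommMonoid D] [Module ℝ≥0 D] {f : C → D}

theorem IsLocallyConvexCone.of_isInducing [TopologicalSpace D] (h : IsLocallyConvexCone D)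
    (hf : IsInducing f) (hl : IsLinearMap ℝ≥0 f) : IsLocallyConvexCone C := by
  intro x U hU hx
  obtain ⟨V, hV, rfl⟩ := hf.isOpen_iff.1 hU
  obtain ⟨W, hWV, hxW, hW, hWc⟩ := h (f x) V hV hx
  exact ⟨f ⁻¹' W, preimage_mono hWV, hxW, hW.preimage hf.continuous, hWc.is_linear_preimage hl⟩

theorem IsWeaklyLocallyConvexCone.of_isInducing [TopologicalSpace D]
    (h : IsWeaklyLocallyConvexCone D) (hf : IsInducing f) (hl : IsLinearMap ℝ≥0 f) :
    IsWeaklyLocallyConvexCone C := by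
  intro x U hU hx
  obtain ⟨V, hV, rfl⟩ := hf.isOpen_iff.1 hU
  obtain ⟨N, hNV, hN, hNc⟩ := h (f x) V hV hx
  exact ⟨f ⁻¹' N, preimage_mono hNV, hf.continuous.continuousAt.preimage_mem_nhds hN,
    hNc.is_linear_preimage hl⟩

theorem IsLocallyLinearCone.of_isInducing [TopologicalSpace D] (h : IsLocallyLinearCone D)
    (hf : IsInducing f) (hl : IsLinearMap ℝ≥0 f) : IsLocallyLinearCone C := by
  obtain ⟨S, hS, hgen⟩ := h
  refine ⟨preimage f '' S, ?_, ?_⟩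
  · rintro _ ⟨U, hU, rfl⟩
    obtain ⟨ho, hc, hc'⟩ := hS U hU
    exact ⟨ho.preimage hf.continuous, hc.is_linear_preimage hl, hc'.is_linear_preimage hl⟩
  · rw [hf.eq_induced, hgen, induced_generateFrom_eq]

end Pullback

theorem mainTheorem6 (K : ∀ (X : Type u) [TopologicalSpace X], Prop) (hK : IsKCategory K)
    (C : Type u) [TopologicalSpace C] [AddCommMonoid C] [Module ℝ≥0 C]
    (hC : IsTopologicalCone C) :
    (∀ s s' : ConeStructure (KCompletion K C),
      IsKConeExtension K C s → IsKConeExtension K C s' → s = s') ∧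
    (IsLocallyConvexCone C ↔
      ∃ s : ConeStructure (KCompletion K C), IsKConeExtension K C s ∧
        @IsLocallyConvexCone (KCompletion K C) _ s.addCommMonoid s.module) ∧
    (IsLocallyLinearCone C ↔
      ∃ s : ConeStructure (KCompletion K C), IsKConeExtension K C s ∧
        @IsLocallyLinearCone (KCompletion K C) _ s.addCommMonoid s.module) ∧
    (IsWeaklyLocallyConvexCone C ↔
      ∃ s : ConeStructure (KCompletion K C), IsKConeExtension K C s ∧
        @IsWeaklyLocallyConvexCone (KCompletion K C) _ s.addCommMonoid s.module) := by
  -- The backward direction works for any admissible `s`, since the unit is inducing and linear for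
  -- each; uniqueness is not needed.
  have key : ∀ (P : ∀ (D : Type u) [TopologicalSpace D] [AddCommMonoid D] [Module ℝ≥0 D], Prop),
      (P C → @P (KCompletion K C) _ (KCompletion.addCommMonoid hK hC)
        (KCompletion.module hK hC)) →
      (∀ (D : Type u) [TopologicalSpace D] [AddCommMonoid D] [Module ℝ≥0 D] (f : C → D),
        P D → IsInducing f → IsLinearMap ℝ≥0 f → P C) →
      (P C ↔ ∃ s : ConeStructure (KCompletion K C), IsKConeExtension K C s ∧
        @P (KCompletion K C) _ s.addCommMonoid s.module) := by
    refine fun P h₁ h₂ => ⟨fun h => ⟨_, KCompletion.isKConeExtension_coneStructure hK hC, h₁ h⟩, ?_⟩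
    rintro ⟨s, hs, h⟩
    let _ := s.addCommMonoid
    let _ := s.module
    exact h₂ _ _ h KCompletion.isInducing_unit hs.2.2
  exact ⟨fun _ _ => KCompletion.coneStructure_unique,
    key _ (KCompletion.isLocallyConvexCone hK hC) fun _ _ _ _ _ h => h.of_isInducing,
    key _ (KCompletion.isLocallyLinearCone hK hC) fun _ _ _ _ _ h => h.of_isInducing,
    key _ (KCompletion.isWeaklyLocallyConvexCone hK hC) fun _ _ _ _ _ h => h.of_isInducing⟩
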